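/- Let $(W,S)$ be a Coxeter system and let $\theta$ be an involutive automorphism of it, i.e. a group automorphism of $W$ with $\theta^2=\mathrm{id}$ and $\theta(S)=S$ (the identity is allowed). Let $\iota(\theta)=\{\theta(w)w^{-1} : w\in W\}$ be the set of twisted identities, and let $\mathrm{Br}(\iota(\theta))$ be this set with the order induced by the Bruhat order on $W$. A special partial matching (SPM) on a finite poset $P$ with maximum $\hat 1$ and cover relation $\lhd$ is a map $M:P\to P$ such that (i) $M^2=\mathrm{id}$; (ii) $M(\hat 1)\lhd\hat 1$; (iii) for every $x\in P$, $M(x)\lhd x$, $M(x)=x$ or $x\lhd M(x)$; (iv) if $x\lhd y$ and $M(x)\neq y$, then $M(x)<M(y)$. A poset $P$ is a pircon if, for every non-minimal $x\in P$, the order ideal $P_{\le x}=\{y\in P: y\le x\}$ is finite and admits an SPM. Suppose that $\theta$ has the no odd flip (NOF) property: $s\theta(s)$ has even or infinite order for every $s\in S$ with $s\neq\theta(s)$. Then $\mathrm{Br}(\iota(\theta))$ is a pircon. Moreover, whenever $w\in\iota(\theta)$ and $s\in S$ satisfy $ws<w$ in the Bruhat order, the order ideal $\mathrm{Br}(\iota(\theta))_{\le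 w}$ is finite, and $x\mapsto\theta(s)xs$ maps it to itself and is an SPM on it. -/

import Mathlib

/-- A special partial matching on a poset `P` with maximum `⊤`; `⋖` is the cover relation of `P`.
(It is only used for finite `P`, see `IsPircon`.) -/
structure IsSPM {P : Type*} [PartialOrder P] [OrderTop P] (M : P → P) : Prop where
  involutive : ∀ x, M (M x) = x
  top_covBy : M ⊤ ⋖ ⊤
  covBy_or : ∀ x, M x ⋖ x ∨ M x = x ∨ x ⋖ M x
  lt_of_covBy : ∀ x y, x ⋖ y → M x ≠ y → M x < M y

/-- A poset is a pircon if every principal order ideal generated by a non-minimal element is finite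
and admits a special partial matching. -/
def IsPircon (P : Type*) [PartialOrder P] : Prop :=
  ∀ x : P, ¬ IsMin x → Finite (Set.Iic x) ∧ ∃ M : Set.Iic x → Set.Iic x, IsSPM M

namespace CoxeterSystem

variable {B W : Type*} [Group W] {M : CoxeterMatrix B}

/-- An edge of the Bruhat graph: `v = u * t` for a reflection `t`, and `u` is shorter than `v`. -/
def BruhatStep (cs : CoxeterSystem M W) (u v : W) : Prop :=
  (∃ t, cs.IsReflection t ∧ v = u * t) ∧ cs.length u < cs.length v

/-- The Bruhat order on `W`. -/
def BruhatLE (cs : CoxeterSystem M W) (u v : W) : Prop :=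
  Relation.ReflTransGen cs.BruhatStep u v

/-- The strict Bruhat order on `W`. -/
def BruhatLT (cs : CoxeterSystem M W) (u v : W) : Prop :=
  cs.BruhatLE u v ∧ u ≠ v

theorem BruhatLE.eq_or_length_lt {cs : CoxeterSystem M W} {u v : W} (h : cs.BruhatLE u v) :
    u = v ∨ cs.length u < cs.length v := by
  induction h with
  | refl => exact Or.inl rfl
  | tail _ hstep ih =>
    rcases ih with rfl | ih
    · exact Or.inr hstep.2
    · exact Or.inr (ih.trans hstep.2)

/-- The subset `X` of `W`, as a type that carries the order induced by the Bruhat order. -/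
@[ext]
structure Br (cs : CoxeterSystem M W) (X : Set W) where
  val : W
  mem : val ∈ X

instance (cs : CoxeterSystem M W) (X : Set W) : PartialOrder (cs.Br X) where
  le x y := cs.BruhatLE x.val y.val
  le_refl _ := Relation.ReflTransGen.refl
  le_trans _ _ _ h₁ h₂ := Relation.ReflTransGen.trans h₁ h₂
  le_antisymm x y h₁ h₂ := by
    rcases h₁.eq_or_length_lt with h | h
    · exact Br.ext h
    · rcases h₂.eq_or_length_lt with h' | h'
      · exact Br.ext h'.symm
      · exact absurd h' h.asymm

/-- `θ` is an involutive automorphism of the Coxeter system: a group automorphism with `θ² = id`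
that maps the set of simple reflections to itself (`θ = id` is allowed). -/
structure IsInvolutiveAut (cs : CoxeterSystem M W) (θ : W ≃* W) : Prop where
  involutive : ∀ w, θ (θ w) = w
  map_simple : ∀ i, ∃ j, θ (cs.simple i) = cs.simple j

/-- The no odd flip property. -/
def IsNOF (cs : CoxeterSystem M W) (θ : W ≃* W) : Prop :=
  ∀ i, cs.simple i ≠ θ (cs.simple i) →
    Even (orderOf (cs.simple i * θ (cs.simple i))) ∨
      ¬ IsOfFinOrder (cs.simple i * θ (cs.simple i))

end CoxeterSystem

/-- The set of twisted identities `θ(w)w⁻¹`. -/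
def twistedIdentities {W : Type*} [Group W] (θ : W ≃* W) : Set W :=
  {x | ∃ w, x = θ w * w⁻¹}

/-! Put M(x) = θ(s)xs. At a descent s of a twisted identity x, M lowers the length by exactly 2
(`twistedConj_ne_self` excludes a fixed point); at an ascent it fixes x or raises the length by 2.
Lengths of twisted identities are even, so these moves are covers. The lifting property of the
Bruhat order keeps M inside the ideal and gives axiom (iv) for x ⋖ y, except when s is an ascent of
both and M(y) = y. Then M(x) = x is needed.

This is where NOF enters. `IsNOF.twistedConj_eq_self` settles the case ℓ(y) = ℓ(x) + 2, and
`IsNOF.exists_between` deduces from it that covers always have this length difference. For the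
former, descend from y by alternating s with a second simple reflection down to some c without
descents in their dihedral group. Then y = θ(u)cu⁻¹, and r = u⁻¹su satisfies θ(r)c = cr. NOF forces
r to be simple; x descends in parallel, and induction applies below c.

The algebraic core is `IsNOF.map_eq_self`, which prevents c from interchanging the two dihedral
generators. Its induction conjugates by θ-fixed involutions: a θ-fixed simple reflection, or the
longest element of ⟨s, θ(s)⟩, which under NOF is a power of sθ(s). Descents and inversions are
controlled throughout by the sign cocycle `eta`, a form of strong exchange. -/

namespace CoxeterSystem

/-! ### The sign cocycle and strong exchange. -/

variable {B W : Type*} [Group W] {M : CoxeterMatrix B} (cs : CoxeterSystem M W)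

open Classical in
/-- The action of the simple reflection `i` on pairs (group element, sign), which conjugates the
element and changes the sign exactly at `cs.simple i`. -/
noncomputable def signPerm (i : B) : Equiv.Perm (W × ZMod 2) :=
  Function.Involutive.toPerm
    (fun p ↦ (cs.simple i * p.1 * cs.simple i, p.2 + if p.1 = cs.simple i then 1 else 0)) (by
      rintro ⟨t, ε⟩
      have h : cs.simple i * t * cs.simple i = cs.simple i ↔ t = cs.simple i := by
        constructor
        · intro h
          have := congrArg (fun x ↦ cs.simple i * x * cs.simple i) h
          simpa [mul_assoc] using this
        · rintro rfl
          simp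
      ext1
      · simp [mul_assoc]
      · by_cases ht : t = cs.simple i <;> simp [h, ht, add_assoc, CharTwo.add_self_eq_zero])

open Classical in
theorem signPerm_apply (i : B) (t : W) (ε : ZMod 2) :
    cs.signPerm i (t, ε) =
      (cs.simple i * t * cs.simple i, ε + if t = cs.simple i then 1 else 0) := rfl

theorem simple_mul_mul_pow (i j : B) (k : ℕ) :
    cs.simple j * (cs.simple i * cs.simple j) ^ k * cs.simple j
      = ((cs.simple i * cs.simple j) ^ k)⁻¹ := by
  induction k with
  | zero => simp
  | succ k ih =>
    have h : cs.simple j * (cs.simple i * cs.simple j) ^ (k + 1) * cs.simple j =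
        cs.simple j * cs.simple i *
          (cs.simple j * (cs.simple i * cs.simple j) ^ k * cs.simple j) := by
      simp [pow_succ', mul_assoc]
    rw [h, ih, pow_succ]
    simp

open Classical in
theorem signPerm_mul_pow_apply (i j : B) (k : ℕ) (t : W) (ε : ZMod 2) :
    ((cs.signPerm i * cs.signPerm j) ^ k) (t, ε) =
      ((cs.simple i * cs.simple j) ^ k * t * ((cs.simple i * cs.simple j) ^ k)⁻¹,
        ε + ∑ l ∈ Finset.range (2 * k),
          if t = cs.simple j * (cs.simple i * cs.simple j) ^ l then 1 else 0) := by
  induction k with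
  | zero => simp
  | succ k ih =>
    set g := cs.simple i * cs.simple j with hg
    have hc := cs.simple_mul_mul_pow i j k
    rw [← hg] at hc
    have hc' : cs.simple j * g ^ k = (g ^ k)⁻¹ * cs.simple j := by
      rw [← hc]; simp
    have h1 : g ^ k * t * (g ^ k)⁻¹ = cs.simple j ↔ t = cs.simple j * g ^ (2 * k) := by
      rw [mul_inv_eq_iff_eq_mul, ← eq_inv_mul_iff_mul_eq, two_mul, pow_add, ← mul_assoc, ← mul_assoc,
        hc']
    have h2 : cs.simple j * (g ^ k * t * (g ^ k)⁻¹) * cs.simple j = cs.simple i ↔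
        t = cs.simple j * g ^ (2 * k + 1) := by
      have e : cs.simple j * g ^ (2 * k + 1) = (g ^ k)⁻¹ * (cs.simple j * g) * g ^ k := by
        rw [show 2 * k + 1 = k + 1 + k by ring, pow_add, pow_succ, ← mul_assoc, ← mul_assoc, hc']
        simp only [mul_assoc]
      have e' (x : W) : cs.simple j * x * cs.simple j = cs.simple i ↔ x = cs.simple j * g := by
        rw [← eq_mul_inv_iff_mul_eq, ← eq_inv_mul_iff_mul_eq, hg]
        simp
      rw [e, e', mul_inv_eq_iff_eq_mul, ← eq_inv_mul_iff_mul_eq]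
      simp only [mul_assoc]
    rw [pow_succ', Equiv.Perm.mul_apply, ih, Equiv.Perm.mul_apply, signPerm_apply, signPerm_apply,
      show 2 * (k + 1) = 2 * k + 1 + 1 by ring, Finset.sum_range_succ, Finset.sum_range_succ]
    simp only [h1, h2]
    ext1
    · simp [pow_succ', hg, mul_assoc]
    · simp [add_assoc]

/-- For k = M i j the sign changes at s_j(s_i s_j)^l, l < 2k, form two identical halves, which
cancel modulo 2. -/
theorem isLiftable_signPerm : M.IsLiftable cs.signPerm := by
  classical
  intro i j
  ext1 ⟨t, ε⟩
  rw [signPerm_mul_pow_apply, two_mul, Finset.sum_range_add]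
  simp [pow_add, CharTwo.add_self_eq_zero]

/-- The action of the Coxeter group on signed elements. -/
noncomputable def signRep : W →* Equiv.Perm (W × ZMod 2) :=
  cs.lift ⟨cs.signPerm, cs.isLiftable_signPerm⟩

/-- The sign cocycle: on a reflection `t`, it is `1` exactly if `t` is a right inversion of `w`. -/
noncomputable def eta (w t : W) : ZMod 2 := (cs.signRep w (t, 0)).2

theorem signRep_simple (i : B) : cs.signRep (cs.simple i) = cs.signPerm i :=
  cs.lift_apply_simple cs.isLiftable_signPerm i

open Classical in
theorem signRep_wordProd_apply (ω : List B) (t : W) (ε : ZMod 2) :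
    cs.signRep (cs.wordProd ω) (t, ε) =
      (cs.wordProd ω * t * (cs.wordProd ω)⁻¹, ε + ((cs.rightInvSeq ω).count t : ZMod 2)) := by
  induction ω with
  | nil => simp
  | cons i ω ih =>
    rw [wordProd_cons, map_mul, Equiv.Perm.mul_apply, ih, signRep_simple, signPerm_apply,
      rightInvSeq, List.count_cons]
    have h : cs.wordProd ω * t * (cs.wordProd ω)⁻¹ = cs.simple i ↔
        (cs.wordProd ω)⁻¹ * cs.simple i * cs.wordProd ω = t := by
      rw [mul_inv_eq_iff_eq_mul, ← eq_inv_mul_iff_mul_eq, mul_assoc, eq_comm]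
    ext1
    · simp [mul_assoc]
    · by_cases ht : (cs.wordProd ω)⁻¹ * cs.simple i * cs.wordProd ω = t <;>
        simp [h, ht, add_assoc]

-- The left side does not see the word, so the parity of the multiplicity of t in an inversion
-- sequence is intrinsic to the element.
open Classical in
theorem eta_wordProd (ω : List B) (t : W) :
    cs.eta (cs.wordProd ω) t = ((cs.rightInvSeq ω).count t : ZMod 2) := by
  simp [eta, signRep_wordProd_apply]

theorem signRep_apply (w t : W) (ε : ZMod 2) :
    cs.signRep w (t, ε) = (w * t * w⁻¹, ε + cs.eta w t) := by
  classical
  obtain ⟨ω, rfl⟩ := cs.wordProd_surjective w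
  rw [signRep_wordProd_apply, eta_wordProd]

theorem eta_mul (v w t : W) : cs.eta (v * w) t = cs.eta w t + cs.eta v (w * t * w⁻¹) := by
  conv_lhs => rw [eta, map_mul, Equiv.Perm.mul_apply, signRep_apply, signRep_apply]
  simp

@[simp]
theorem eta_one (t : W) : cs.eta 1 t = 0 := by
  simp [eta]

open Classical in
theorem eta_simple (i : B) (t : W) : cs.eta (cs.simple i) t = if t = cs.simple i then 1 else 0 := by
  simp [eta, signRep_simple, signPerm_apply]

theorem zmod_two_eq (a : ZMod 2) : a = 0 ∨ a = 1 := by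
  revert a
  decide

theorem eta_inv (w t : W) : cs.eta w⁻¹ t = cs.eta w (w⁻¹ * t * w) := by
  have h := cs.eta_mul w w⁻¹ t
  rw [mul_inv_cancel, eta_one, inv_inv] at h
  exact CharTwo.add_eq_zero.mp h.symm

theorem mem_rightInvSeq_of_eta {ω : List B} {t : W} (h : cs.eta (cs.wordProd ω) t = 1) :
    t ∈ cs.rightInvSeq ω := by
  classical
  by_contra hn
  rw [eta_wordProd, List.count_eq_zero_of_not_mem hn] at h
  simp at h

theorem eta_self {t : W} (ht : cs.IsReflection t) : cs.eta t t = 1 := by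
  obtain ⟨w, i, rfl⟩ := ht
  have h := cs.eta_mul w w⁻¹ (w * cs.simple i * w⁻¹)
  rw [mul_inv_cancel, eta_one] at h
  rw [eta_mul, eta_mul, eta_simple]
  simp only [mul_assoc, inv_mul_cancel, mul_one, inv_inv, inv_mul_cancel_left] at h ⊢
  simp only [inv_simple, simple_mul_simple_self, mul_one, if_true]
  rw [← add_assoc, add_right_comm, ← h, zero_add]

theorem length_lt_of_eta {w t : W} (h : cs.eta w t = 1) :
    cs.length (w * t) < cs.length w := by
  obtain ⟨ω, hω, rfl⟩ := cs.exists_isReduced w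
  exact (cs.isRightInversion_of_mem_rightInvSeq hω (cs.mem_rightInvSeq_of_eta h)).2

theorem eta_eq_one_iff {w t : W} (ht : cs.IsReflection t) :
    cs.eta w t = 1 ↔ cs.length (w * t) < cs.length w := by
  refine ⟨cs.length_lt_of_eta, fun h ↦ ?_⟩
  rcases zmod_two_eq (cs.eta w t) with h0 | h1
  -- A reflection not counted for w is counted for wt, so the implication already proved applies to
  -- wt.
  · have h1 : cs.eta (w * t) t = 1 := by
      rw [eta_mul, eta_self cs ht]
      simp [ht.inv, ht.mul_self, h0]
    have := cs.length_lt_of_eta h1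
    rw [mul_assoc, ht.mul_self, mul_one] at this
    omega
  · exact h1

theorem eta_eq_zero_iff {w t : W} (ht : cs.IsReflection t) :
    cs.eta w t = 0 ↔ cs.length w < cs.length (w * t) := by
  have h := cs.eta_eq_one_iff (w := w) ht
  have hne := ht.length_mul_left_ne w
  rcases zmod_two_eq (cs.eta w t) with h0 | h1
  · rw [h0] at h
    simp only [zero_ne_one, false_iff] at h
    simp only [h0, true_iff]
    omega
  · rw [h1] at h
    simp only [true_iff] at h
    simp only [h1, one_ne_zero, false_iff]
    omega

/-- A reflection that commutes with one of its descents is equal to it. -/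
theorem eq_simple_of_commute {r : W} {i : B} (hr : cs.IsReflection r)
    (hc : r * cs.simple i = cs.simple i * r) (hd : cs.length (r * cs.simple i) < cs.length r) :
    r = cs.simple i := by
  classical
  rw [← cs.eta_eq_one_iff (cs.isReflection_simple i)] at hd
  obtain ⟨v, j, rfl⟩ := hr
  have h0 := cs.eta_inv v (cs.simple i)
  have hst : cs.simple j * (v⁻¹ * cs.simple i * v) * cs.simple j = v⁻¹ * cs.simple i * v := by
    have := congrArg (fun x ↦ v⁻¹ * x * v * cs.simple j) hc
    simpa [mul_assoc] using this
  -- With r = v s_j v⁻¹, commutation makes the terms of v and v⁻¹ agree and cancel, leaving the term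
  -- of s_j at v⁻¹ s_i v.
  rw [eta_mul, eta_mul, inv_inv, inv_simple, hst, h0, add_comm, add_assoc,
    CharTwo.add_self_eq_zero, add_zero, eta_simple] at hd
  by_cases h : v⁻¹ * cs.simple i * v = cs.simple j
  · rw [← h]
    simp [mul_assoc]
  · simp [h] at hd

/-- If s_i is a descent of s_j x but not of x, the inversion is due to s_j alone, so x s_i x⁻¹ =
s_j. -/
theorem simple_mul_eq_or_length_add_two {x : W} {i j : B}
    (hi : cs.length x < cs.length (x * cs.simple i))
    (hj : cs.length x < cs.length (cs.simple j * x)) :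
    cs.simple j * x = x * cs.simple i ∨
      cs.length (cs.simple j * x * cs.simple i) = cs.length x + 2 := by
  classical
  by_cases h : cs.length (cs.simple j * x * cs.simple i) < cs.length (cs.simple j * x)
  · left
    rw [← cs.eta_eq_one_iff (cs.isReflection_simple i), eta_mul,
      (cs.eta_eq_zero_iff (cs.isReflection_simple i)).mpr hi, eta_simple, zero_add] at h
    by_contra hne
    rw [if_neg] at h
    · exact zero_ne_one h
    · rw [mul_inv_eq_iff_eq_mul]
      exact fun h' ↦ hne h'.symm
  · right
    have h1 := cs.length_mul_simple (cs.simple j * x) i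
    have h2 := cs.length_simple_mul x j
    omega

theorem simple_mul_eq_or_length_eq_add_two {x : W} {i j : B}
    (hi : cs.length (x * cs.simple i) < cs.length x)
    (hj : cs.length (cs.simple j * x) < cs.length x) :
    cs.simple j * x = x * cs.simple i ∨
      cs.length x = cs.length (cs.simple j * x * cs.simple i) + 2 := by
  have h1 := cs.length_mul_simple (cs.simple j * x) i
  have h2 := cs.length_simple_mul x j
  have h3 := cs.length_mul_simple x i
  by_cases h : cs.length (cs.simple j * x) < cs.length (cs.simple j * x * cs.simple i)
  · have := cs.simple_mul_eq_or_length_add_two (x := x * cs.simple i) (i := i) (j := j)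
      (by simpa using hi) (by rw [← mul_assoc]; omega)
    simp only [← mul_assoc, simple_mul_simple_cancel_right] at this
    left
    rcases this with h' | h'
    · have := congrArg (· * cs.simple i) h'
      simpa using this
    · omega
  · omega

/-! ### The Bruhat order -/

variable {cs}

theorem BruhatLE.length_le {u v : W} (h : cs.BruhatLE u v) : cs.length u ≤ cs.length v := by
  rcases h.eq_or_length_lt with rfl | h
  · exact le_rfl
  · exact h.le

theorem BruhatLE.eq_of_length_le {u v : W} (h : cs.BruhatLE u v)
    (hl : cs.length v ≤ cs.length u) : u = v := by
  rcases h.eq_or_length_lt with rfl | h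
  · rfl
  · omega

theorem BruhatLE.trans {u v w : W} (h : cs.BruhatLE u v) (h' : cs.BruhatLE v w) :
    cs.BruhatLE u w := Relation.ReflTransGen.trans h h'

theorem BruhatStep.inv {u v : W} (h : cs.BruhatStep u v) : cs.BruhatStep u⁻¹ v⁻¹ := by
  obtain ⟨⟨t, ht, rfl⟩, hl⟩ := h
  refine ⟨⟨u * t * u⁻¹, ht.conj u, ?_⟩, ?_⟩
  · simp [mul_assoc, ht.inv]
  · simpa only [length_inv] using hl

theorem BruhatLE.inv {u v : W} (h : cs.BruhatLE u v) : cs.BruhatLE u⁻¹ v⁻¹ :=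
  Relation.ReflTransGen.lift (·⁻¹) (fun _ _ h ↦ BruhatStep.inv h) _ _ h

theorem BruhatLE.of_inv {u v : W} (h : cs.BruhatLE u⁻¹ v⁻¹) : cs.BruhatLE u v := by
  simpa using h.inv

/-- Conjugation by s_i matches the inversions of u and u s_i other than s_i, so only the edge
labelled s_i can be reversed. -/
theorem BruhatStep.mul_simple {u v : W} (h : cs.BruhatStep u v) (i : B)
    (hne : v ≠ u * cs.simple i) : cs.BruhatStep (u * cs.simple i) (v * cs.simple i) := by
  classical
  obtain ⟨⟨t, ht, rfl⟩, hl⟩ := h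
  have hts : t ≠ cs.simple i := fun h ↦ hne (by rw [h])
  have ht' : cs.IsReflection (cs.simple i * t * cs.simple i) := by
    simpa using ht.conj (cs.simple i)
  have e : u * t * cs.simple i = u * cs.simple i * (cs.simple i * t * cs.simple i) := by
    simp [mul_assoc]
  refine ⟨⟨_, ht', e⟩, ?_⟩
  rw [e, ← cs.eta_eq_zero_iff ht', eta_mul, eta_simple, if_neg]
  · have : cs.simple i * (cs.simple i * t * cs.simple i) * (cs.simple i)⁻¹ = t := by
      simp [mul_assoc]
    rw [this, zero_add, cs.eta_eq_zero_iff ht]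
    exact hl
  · intro h
    apply hts
    have := congrArg (fun x ↦ cs.simple i * x * cs.simple i) h
    simpa [mul_assoc] using this

theorem bruhatLE_mul_simple {u : W} {i : B} (h : cs.length u < cs.length (u * cs.simple i)) :
    cs.BruhatLE u (u * cs.simple i) :=
  .single ⟨⟨_, cs.isReflection_simple i, rfl⟩, h⟩

theorem mul_simple_bruhatLE {u : W} {i : B} (h : cs.length (u * cs.simple i) < cs.length u) :
    cs.BruhatLE (u * cs.simple i) u :=
  .single ⟨⟨_, cs.isReflection_simple i, by simp⟩, h⟩

/-- Lifting property: translate the chain by s_i edge by edge; at an edge labelled s_i the translate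
rejoins the original chain. -/
theorem BruhatLE.mul_simple_le {u v : W} {i : B} (h : cs.BruhatLE u v)
    (hv : cs.length (v * cs.simple i) < cs.length v) : cs.BruhatLE (u * cs.simple i) v := by
  induction h using Relation.ReflTransGen.head_induction_on with
  | refl => exact mul_simple_bruhatLE hv
  | @head u u' hs hle ih =>
    by_cases he : u' = u * cs.simple i
    · rw [← he]
      exact hle
    · exact .trans (.single (hs.mul_simple i he)) ih

theorem BruhatLE.le_mul_simple {u v : W} {i : B} (h : cs.BruhatLE u v)
    (hu : cs.length u < cs.length (u * cs.simple i)) : cs.BruhatLE u (v * cs.simple i) := by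
  induction h with
  | refl => exact bruhatLE_mul_simple hu
  | @tail v' v hle hs ih =>
    by_cases he : v = v' * cs.simple i
    · rw [he]
      rwa [simple_mul_simple_cancel_right]
    · exact .trans ih (.single (hs.mul_simple i he))

theorem length_inv_mul_simple (u : W) (i : B) :
    cs.length (u⁻¹ * cs.simple i) = cs.length (cs.simple i * u) := by
  rw [← length_inv]
  simp

theorem BruhatLE.simple_mul_le {u v : W} {i : B} (h : cs.BruhatLE u v)
    (hv : cs.length (cs.simple i * v) < cs.length v) : cs.BruhatLE (cs.simple i * u) v := by
  apply BruhatLE.of_inv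
  rw [mul_inv_rev, inv_simple]
  exact h.inv.mul_simple_le (by rwa [length_inv_mul_simple, length_inv])

theorem BruhatLE.le_simple_mul {u v : W} {i : B} (h : cs.BruhatLE u v)
    (hu : cs.length u < cs.length (cs.simple i * u)) : cs.BruhatLE u (cs.simple i * v) := by
  apply BruhatLE.of_inv
  rw [mul_inv_rev, inv_simple]
  exact h.inv.le_mul_simple (by rwa [length_inv_mul_simple, length_inv])

theorem finite_setOf_bruhatLE (w : W) : {u | cs.BruhatLE u w}.Finite := by
  induction hn : cs.length w using Nat.strong_induction_on generalizing w with
  | _ n ih =>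
    by_cases hw : w = 1
    · refine (Set.finite_singleton (1 : W)).subset fun u hu ↦ ?_
      have := BruhatLE.length_le hu
      rw [hw, length_one, Nat.le_zero, length_eq_zero_iff] at this
      exact this
    · obtain ⟨i, hi⟩ := cs.exists_rightDescent_of_ne_one hw
      have hi' : cs.length (w * cs.simple i) < cs.length w := hi
      have hf := ih _ (hn ▸ hi') (w * cs.simple i) rfl
      refine (hf.union (hf.image (· * cs.simple i))).subset fun u hu ↦ ?_
      rcases lt_or_gt_of_ne (cs.length_mul_simple_ne u i) with h | h
      · right
        refine ⟨u * cs.simple i, ?_, by simp⟩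
        exact ((mul_simple_bruhatLE h).trans hu).le_mul_simple (by simpa using h)
      · exact Or.inl (BruhatLE.le_mul_simple hu h)

end CoxeterSystem

/-! ### Parabolic and dihedral subgroups. -/

namespace CoxeterSystem

variable {B W : Type*} [Group W] {M : CoxeterMatrix B} (cs : CoxeterSystem M W)

/-- The standard parabolic subgroup of type `J`. -/
def parabolic (J : Set B) : Subgroup W := Subgroup.closure (cs.simple '' J)

variable {cs} {J : Set B}

theorem simple_mem_parabolic {j : B} (hj : j ∈ J) : cs.simple j ∈ cs.parabolic J :=
  Subgroup.subset_closure ⟨j, hj, rfl⟩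

theorem wordProd_mem_parabolic {ω : List B} (h : ∀ k ∈ ω, k ∈ J) :
    cs.wordProd ω ∈ cs.parabolic J := by
  induction ω with
  | nil => simp
  | cons i ω ih =>
    rw [wordProd_cons]
    exact mul_mem (simple_mem_parabolic (h i (by simp))) (ih fun k hk ↦ h k (by simp [hk]))

theorem exists_word_of_mem_parabolic {w : W} (h : w ∈ cs.parabolic J) :
    ∃ ω : List B, (∀ k ∈ ω, k ∈ J) ∧ w = cs.wordProd ω := by
  induction h using Subgroup.closure_induction with
  | mem x hx =>
    obtain ⟨j, hj, rfl⟩ := hx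
    exact ⟨[j], by simpa using hj, by simp⟩
  | one => exact ⟨[], by simp, by simp⟩
  | mul x y _ _ hx hy =>
    obtain ⟨ω, h, rfl⟩ := hx
    obtain ⟨ω', h', rfl⟩ := hy
    refine ⟨ω ++ ω', fun k hk ↦ ?_, by rw [wordProd_append]⟩
    rcases List.mem_append.mp hk with hk | hk
    exacts [h k hk, h' k hk]
  | inv x _ hx =>
    obtain ⟨ω, h, rfl⟩ := hx
    exact ⟨ω.reverse, by simpa using h, by simp⟩

theorem mem_parabolic_of_mem_rightInvSeq {ω : List B} (h : ∀ k ∈ ω, k ∈ J) {t : W}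
    (ht : t ∈ cs.rightInvSeq ω) : t ∈ cs.parabolic J := by
  induction ω with
  | nil => simp at ht
  | cons i ω ih =>
    have hω : ∀ k ∈ ω, k ∈ J := fun k hk ↦ h k (by simp [hk])
    rcases List.mem_cons.mp ht with rfl | ht
    · exact mul_mem (mul_mem (inv_mem (wordProd_mem_parabolic hω))
        (simple_mem_parabolic (h i (by simp)))) (wordProd_mem_parabolic hω)
    · exact ih hω ht

theorem mem_parabolic_of_eta {r t : W} (hr : r ∈ cs.parabolic J) (h : cs.eta r t = 1) :
    t ∈ cs.parabolic J := by
  obtain ⟨ω, hω, rfl⟩ := exists_word_of_mem_parabolic hr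
  exact mem_parabolic_of_mem_rightInvSeq hω (cs.mem_rightInvSeq_of_eta h)

/-- If the last letter is not an inversion of the product, it is one of the remaining word, and the
deletion shortens the word by two letters without leaving J. -/
theorem exists_eta_of_wordProd_ne_one (ω : List B) (h : ∀ k ∈ ω, k ∈ J)
    (hne : cs.wordProd ω ≠ 1) : ∃ j ∈ J, cs.eta (cs.wordProd ω) (cs.simple j) = 1 := by
  classical
  induction hn : ω.length using Nat.strong_induction_on generalizing ω with
  | _ n ih =>
    rcases List.eq_nil_or_concat ω with rfl | ⟨ω', b, rfl⟩
    · simp at hne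
    have hb : b ∈ J := h b (by simp)
    have hω' : ∀ k ∈ ω', k ∈ J := fun k hk ↦ h k (by simp [hk])
    rcases zmod_two_eq (cs.eta (cs.wordProd (ω'.concat b)) (cs.simple b)) with h0 | h1
    · have h1 : cs.eta (cs.wordProd ω') (cs.simple b) = 1 := by
        rw [wordProd_concat, eta_mul, eta_simple, if_pos rfl] at h0
        simpa using (CharTwo.add_eq_zero.mp h0).symm
      obtain ⟨k, hk, hk'⟩ := List.getElem_of_mem (cs.mem_rightInvSeq_of_eta h1)
      have e : cs.wordProd (ω'.concat b) = cs.wordProd (ω'.eraseIdx k) := by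
        rw [← wordProd_mul_getD_rightInvSeq, wordProd_concat, List.getD_eq_getElem _ _ hk, hk']
      rw [e] at hne ⊢
      refine ih (ω'.eraseIdx k).length ?_ _ (fun l hl ↦ hω' l (List.mem_of_mem_eraseIdx hl)) hne rfl
      have := List.length_eraseIdx_le ω' k
      rw [← hn]
      simp
      omega
    · exact ⟨b, hb, h1⟩

theorem exists_eta_of_mem_parabolic {v : W} (hv : v ∈ cs.parabolic J) (hne : v ≠ 1) :
    ∃ j ∈ J, cs.eta v (cs.simple j) = 1 := by
  obtain ⟨ω, hω, rfl⟩ := exists_word_of_mem_parabolic hv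
  exact exists_eta_of_wordProd_ne_one ω hω hne

theorem exists_descent_of_mem_parabolic {v : W} (hv : v ∈ cs.parabolic J) (hne : v ≠ 1) :
    ∃ j ∈ J, cs.length (v * cs.simple j) < cs.length v := by
  obtain ⟨j, hj, h⟩ := exists_eta_of_mem_parabolic hv hne
  exact ⟨j, hj, cs.length_lt_of_eta h⟩

theorem exists_simple_of_mem_parabolic {v : W} (hv : v ∈ cs.parabolic J) (h : cs.length v = 1) :
    ∃ j ∈ J, v = cs.simple j := by
  have hne : v ≠ 1 := by
    rintro rfl
    simp at h
  obtain ⟨j, hj, hd⟩ := exists_descent_of_mem_parabolic hv hne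
  refine ⟨j, hj, ?_⟩
  have h0 : cs.length (v * cs.simple j) = 0 := by omega
  rw [length_eq_zero_iff] at h0
  rw [eq_inv_of_mul_eq_one_left h0, inv_simple]

variable (cs J) in
theorem exists_min_coset_rep (w : W) :
    ∃ x, x⁻¹ * w ∈ cs.parabolic J ∧ ∀ j ∈ J, cs.length x < cs.length (x * cs.simple j) := by
  induction hn : cs.length w using Nat.strong_induction_on generalizing w with
  | _ n ih =>
    by_cases h : ∀ j ∈ J, cs.length w < cs.length (w * cs.simple j)
    · exact ⟨w, by simp, h⟩
    · push Not at h
      obtain ⟨j, hj, hl⟩ := h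
      have hl' := lt_of_le_of_ne hl (cs.length_mul_simple_ne w j)
      obtain ⟨x, hx, hx'⟩ := ih _ (hn ▸ hl') _ rfl
      refine ⟨x, ?_, hx'⟩
      have := mul_mem hx (simple_mem_parabolic (cs := cs) hj)
      simpa [mul_assoc] using this

/-- An element without descents in `J` has no inversions in the parabolic subgroup of type `J`. -/
theorem eta_eq_zero_of_mem_parabolic {c : W}
    (hc : ∀ j ∈ J, cs.length c < cs.length (c * cs.simple j)) {t : W} (ht : cs.IsReflection t)
    (htJ : t ∈ cs.parabolic J) : cs.eta c t = 0 := by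
  -- A shortest element cv of cW_J has no inversion in W_J. If v ≠ 1, a descent of v⁻¹ in J would be
  -- a descent of c = (cv)v⁻¹; so c is itself shortest.
  obtain ⟨x, ⟨v, hv, rfl⟩, hx⟩ := WellFounded.has_min (measure cs.length).wf
    {x | ∃ v ∈ cs.parabolic J, x = c * v} ⟨c, 1, one_mem _, by simp⟩
  have h0 : ∀ t, cs.IsReflection t → t ∈ cs.parabolic J → cs.eta (c * v) t = 0 := by
    intro t ht htJ
    have h : ¬ cs.length (c * v * t) < cs.length (c * v) :=
      hx (c * v * t) ⟨v * t, mul_mem hv htJ, mul_assoc _ _ _⟩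
    rw [← cs.eta_eq_one_iff ht] at h
    exact (zmod_two_eq _).resolve_right h
  by_cases hv1 : v = 1
  · simpa [hv1] using h0 t ht htJ
  · obtain ⟨j, hj, h⟩ := exists_eta_of_mem_parabolic (inv_mem hv) (inv_ne_one.mpr hv1)
    have h1 := cs.eta_mul (c * v) v⁻¹ (cs.simple j)
    rw [h0 _ ((cs.isReflection_simple j).conj v⁻¹)
      (mul_mem (mul_mem (inv_mem hv) (simple_mem_parabolic hj)) (inv_mem (inv_mem hv))), h,
      mul_inv_cancel_right, (cs.eta_eq_zero_iff (cs.isReflection_simple j)).mpr (hc j hj)] at h1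
    simp at h1

theorem eta_mul_of_mem_parabolic {c v : W}
    (hc : ∀ j ∈ J, cs.length c < cs.length (c * cs.simple j)) (hv : v ∈ cs.parabolic J) {j : B}
    (hj : j ∈ J) : cs.eta (c * v) (cs.simple j) = cs.eta v (cs.simple j) := by
  rw [eta_mul, eta_eq_zero_of_mem_parabolic hc ((cs.isReflection_simple j).conj v)
      (mul_mem (mul_mem hv (simple_mem_parabolic hj)) (inv_mem hv)), add_zero]

theorem length_mul_of_mem_parabolic {c v : W}
    (hc : ∀ j ∈ J, cs.length c < cs.length (c * cs.simple j)) (hv : v ∈ cs.parabolic J) :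
    cs.length (c * v) = cs.length c + cs.length v := by
  induction hn : cs.length v using Nat.strong_induction_on generalizing v with
  | _ n ih =>
    by_cases hv1 : v = 1
    · subst hv1
      rw [length_one] at hn
      rw [mul_one, ← hn, add_zero]
    · obtain ⟨j, hj, h⟩ := exists_eta_of_mem_parabolic hv hv1
      have h1 := (eta_mul_of_mem_parabolic hc hv hj).trans h
      have h2 := cs.length_lt_of_eta h
      have h3 := cs.length_lt_of_eta h1
      have h4 := ih _ (hn ▸ h2) (mul_mem hv (simple_mem_parabolic hj)) rfl
      have h5 := cs.length_mul_simple v j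
      have h6 := cs.length_mul_simple (c * v) j
      rw [← mul_assoc] at h4
      omega

theorem mem_closure_pair_of_involutions {G : Type*} [Group G] {a b v : G} (ha : a * a = 1)
    (hb : b * b = 1) (hv : v ∈ Subgroup.closure {a, b}) :
    ∃ k : ℤ, v = (a * b) ^ k ∨ v = (a * b) ^ k * a := by
  have key : ∀ v, (∃ k : ℤ, v = (a * b) ^ k ∨ v = (a * b) ^ k * a) → ∀ y, y = a ∨ y = b →
      ∃ k : ℤ, v * y = (a * b) ^ k ∨ v * y = (a * b) ^ k * a := by
    rintro v ⟨k, rfl | rfl⟩ y (rfl | rfl)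
    · exact ⟨k, Or.inr rfl⟩
    · refine ⟨k - 1, Or.inr ?_⟩
      rw [zpow_sub_one, mul_inv_rev, inv_eq_of_mul_eq_one_left ha, inv_eq_of_mul_eq_one_left hb,
        mul_assoc, mul_assoc, ha, mul_one]
    · exact ⟨k, Or.inl (by rw [mul_assoc, ha, mul_one])⟩
    · exact ⟨k + 1, Or.inl (by rw [zpow_add_one, mul_assoc])⟩
  induction hv using Subgroup.closure_induction_right with
  | one => exact ⟨0, Or.inl (by simp)⟩
  | mul_right x _ y hy ih => exact key _ ih y hy
  | mul_inv_cancel x _ y hy ih =>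
    refine key _ ih _ ?_
    rcases hy with rfl | rfl
    · exact Or.inl (inv_eq_of_mul_eq_one_left ha)
    · exact Or.inr (inv_eq_of_mul_eq_one_left hb)

theorem eq_zpow_of_mem_parabolic_pair {i j : B} {v : W} (hv : v ∈ cs.parabolic {i, j}) :
    ∃ k : ℤ, v = (cs.simple i * cs.simple j) ^ k ∨
      v = (cs.simple i * cs.simple j) ^ k * cs.simple i := by
  rw [parabolic, Set.image_pair] at hv
  exact mem_closure_pair_of_involutions (cs.simple_mul_simple_self i)
    (cs.simple_mul_simple_self j) hv

end CoxeterSystem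

/-! ### The automorphism θ and the no odd flip property. -/

namespace CoxeterSystem

variable {B W : Type*} [Group W] {M : CoxeterMatrix B} {cs : CoxeterSystem M W} {θ : W ≃* W}

namespace IsInvolutiveAut

theorem length_map_le (hθ : cs.IsInvolutiveAut θ) (w : W) : cs.length (θ w) ≤ cs.length w := by
  choose f hf using hθ.map_simple
  have h : ∀ ω : List B, θ (cs.wordProd ω) = cs.wordProd (ω.map f) := by
    intro ω
    induction ω with
    | nil => simp
    | cons i ω ih => rw [wordProd_cons, map_mul, ih, hf, List.map_cons, wordProd_cons]
  obtain ⟨ω, hω, rfl⟩ := cs.exists_isReduced w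
  rw [h, hω.eq, ← List.length_map (as := ω) f]
  exact cs.length_wordProd_le _

theorem length_map (hθ : cs.IsInvolutiveAut θ) (w : W) : cs.length (θ w) = cs.length w := by
  refine le_antisymm (hθ.length_map_le w) ?_
  conv_lhs => rw [← hθ.involutive w]
  exact hθ.length_map_le _

theorem isReflection_map (hθ : cs.IsInvolutiveAut θ) {t : W} (ht : cs.IsReflection t) :
    cs.IsReflection (θ t) := by
  obtain ⟨w, i, rfl⟩ := ht
  obtain ⟨j, hj⟩ := hθ.map_simple i
  exact ⟨θ w, j, by simp [hj]⟩

theorem eta_map (hθ : cs.IsInvolutiveAut θ) (w : W) {t : W} (ht : cs.IsReflection t) :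
    cs.eta (θ w) (θ t) = cs.eta w t := by
  have h : cs.eta (θ w) (θ t) = 1 ↔ cs.eta w t = 1 := by
    rw [cs.eta_eq_one_iff ht, cs.eta_eq_one_iff (hθ.isReflection_map ht), ← map_mul,
      hθ.length_map, hθ.length_map]
  rcases zmod_two_eq (cs.eta w t) with h0 | h1
  · rw [h0]
    rw [h0] at h
    exact (zmod_two_eq _).resolve_right (by simp [h])
  · rw [h1, h, h1]

/-- In a dihedral parabolic subgroup whose generators are exchanged by `θ`, the automorphism
exchanges the two elements of a given length that have opposite descents. -/
theorem map_eq_of_descents (hθ : cs.IsInvolutiveAut θ) {i j : B}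
    (hij : θ (cs.simple i) = cs.simple j) {v v' : W} (hv : v ∈ cs.parabolic {i, j})
    (hv' : v' ∈ cs.parabolic {i, j}) (hl : cs.length v = cs.length v')
    (hd : cs.length (v * cs.simple i) < cs.length v)
    (hd' : cs.length (v' * cs.simple j) < cs.length v') : θ v = v' := by
  induction hn : cs.length v using Nat.strong_induction_on generalizing v v' i j with
  | _ n ih =>
    have hji : θ (cs.simple j) = cs.simple i := by rw [← hij, hθ.involutive]
    have h1 := cs.length_mul_simple v i
    have h1' := cs.length_mul_simple v' j
    have hi : i ∈ ({i, j} : Set B) := by simp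
    have hj : j ∈ ({i, j} : Set B) := by simp
    by_cases h : v * cs.simple i = 1
    · have h2 : v' * cs.simple j = 1 := by
        rw [← cs.length_eq_zero_iff] at h ⊢
        omega
      rw [eq_inv_of_mul_eq_one_left h, eq_inv_of_mul_eq_one_left h2, inv_simple, inv_simple, hij]
    · have h2 : v' * cs.simple j ≠ 1 := by
        rw [← cs.length_eq_zero_iff] at h
        rw [ne_eq, ← cs.length_eq_zero_iff]
        omega
      have hm := mul_mem hv (simple_mem_parabolic (cs := cs) hi)
      have hm' := mul_mem hv' (simple_mem_parabolic (cs := cs) hj)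
      obtain ⟨k, hk, hkd⟩ := exists_descent_of_mem_parabolic hm h
      obtain ⟨k', hk', hkd'⟩ := exists_descent_of_mem_parabolic hm' h2
      have ek : k = j := by
        rcases hk with rfl | rfl
        · rw [simple_mul_simple_cancel_right] at hkd
          omega
        · rfl
      have ek' : k' = i := by
        rcases hk' with rfl | rfl
        · rfl
        · rw [simple_mul_simple_cancel_right] at hkd'
          omega
      subst ek ek'
      rw [Set.pair_comm] at hm hm'
      have := ih _ (by omega) hji hm hm' (by omega) hkd hkd' rfl
      rw [map_mul, hij] at this
      exact mul_right_cancel this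

end IsInvolutiveAut

theorem IsNOF.zpow_ne_one (h : cs.IsNOF θ) {i : B} (hi : cs.simple i ≠ θ (cs.simple i)) (k : ℤ) :
    (cs.simple i * θ (cs.simple i)) ^ (2 * k + 1) ≠ 1 := by
  intro hk
  have he : Even (orderOf (cs.simple i * θ (cs.simple i))) := by
    rcases h i hi with h | h
    · exact h
    -- Infinite order is recorded as 0, which is even, so both cases of NOF merge.
    · rw [orderOf_eq_zero h]
      exact Even.zero
  have h1 := orderOf_dvd_iff_zpow_eq_one.mpr hk
  obtain ⟨m, hm⟩ := he
  rw [hm] at h1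
  obtain ⟨l, hl⟩ := h1
  push_cast at hl
  have : 2 * ((m : ℤ) * l - k) = 1 := by linarith
  omega

/-- A central involution of a dihedral parabolic subgroup: under the no odd flip property, the
longest element of the subgroup generated by `s` and `θ s` is a power of `s * θ s`. -/
theorem IsNOF.longest_eq_zpow (hNOF : cs.IsNOF θ) (hθ : cs.IsInvolutiveAut θ) {i j : B}
    (hij : θ (cs.simple i) = cs.simple j) (hne : cs.simple i ≠ cs.simple j) {v : W}
    (hv : v ∈ cs.parabolic {i, j}) (hd : cs.length (v * cs.simple i) < cs.length v)
    (hd' : cs.length (v * cs.simple j) < cs.length v) :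
    (∃ k : ℤ, v = (cs.simple i * cs.simple j) ^ k) ∧ v * v = 1 ∧ θ v = v := by
  have hji : θ (cs.simple j) = cs.simple i := by rw [← hij, hθ.involutive]
  have hfix := hθ.map_eq_of_descents hij hv hv rfl hd hd'
  have hinv : cs.simple j * cs.simple i = (cs.simple i * cs.simple j)⁻¹ := by simp
  have hz := hNOF.zpow_ne_one (i := i) (by rwa [hij])
  rw [hij] at hz
  obtain ⟨k, rfl | rfl⟩ := eq_zpow_of_mem_parabolic_pair hv
  · refine ⟨⟨k, rfl⟩, ?_, hfix⟩
    rw [map_zpow, map_mul, hij, hji, hinv, inv_zpow] at hfix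
    rw [mul_eq_one_iff_eq_inv, hfix]
  · exfalso
    rw [map_mul, map_zpow, map_mul, hij, hji, hinv, inv_zpow, inv_mul_eq_iff_eq_mul] at hfix
    apply hz k
    rw [zpow_add_one, two_mul, zpow_add]
    have := congrArg (· * cs.simple j) hfix
    simp only [simple_mul_simple_self, mul_assoc] at this ⊢
    exact this.symm

/-- Conjugation by r inverts ab, so the element is the conjugate of r by (ab)^l if k = 2l, and by
(ab)^l a if k = 2l + 1. -/
theorem isReflection_zpow_mul {r a b : W} (hr : cs.IsReflection r) (ha : a * a = 1)
    (hab : r * a * r = b) (k : ℤ) : cs.IsReflection ((a * b) ^ k * r) := by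
  have hrr := hr.mul_self
  have hc : r * (a * b) * r⁻¹ = (a * b)⁻¹ := by
    rw [← hab, hr.inv, mul_inv_rev, mul_inv_rev, mul_inv_rev, hr.inv,
      inv_eq_of_mul_eq_one_left ha]
    simp only [mul_assoc, hrr, mul_one]
  have hz (l : ℤ) : r * ((a * b) ^ l)⁻¹ = (a * b) ^ l * r := by
    rw [← zpow_neg, ← mul_inv_eq_iff_eq_mul, ← conj_zpow, hc, inv_zpow, zpow_neg, inv_inv]
  have hra : r * a = b * r := by
    rw [← hab]
    simp only [mul_assoc, hrr, mul_one]
  obtain ⟨l, rfl | rfl⟩ := Int.even_or_odd' k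
  · have := hr.conj ((a * b) ^ l)
    rwa [mul_assoc, hz, ← mul_assoc, ← zpow_add, ← two_mul] at this
  · have := hr.conj ((a * b) ^ l * a)
    rw [mul_inv_rev, inv_eq_of_mul_eq_one_left ha, mul_assoc, ← mul_assoc r, hra, mul_assoc b, hz]
      at this
    rw [two_mul, add_right_comm, zpow_add, zpow_add_one]
    simpa only [mul_assoc] using this

theorem length_simple_mul_of_involution {r : W} (hr : r * r = 1) (i : B) :
    cs.length (cs.simple i * r) = cs.length (r * cs.simple i) := by
  rw [← length_inv, mul_inv_rev, inv_simple, inv_eq_of_mul_eq_one_left hr]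

/-- Conjugation by an involution at one of its descents decreases the length by two, or it does
nothing. -/
theorem length_conj_of_descent {r : W} (hr : r * r = 1) {i : B}
    (hd : cs.length (r * cs.simple i) < cs.length r) :
    cs.simple i * r = r * cs.simple i ∨
      cs.length r = cs.length (cs.simple i * r * cs.simple i) + 2 :=
  cs.simple_mul_eq_or_length_eq_add_two hd (by rwa [length_simple_mul_of_involution hr])

/-- Under the no odd flip property, `θ` cannot act on an involution `t` as conjugation by a
`θ`-fixed reflection, unless it fixes `t`. -/
theorem IsNOF.map_eq_self (hNOF : cs.IsNOF θ) (hθ : cs.IsInvolutiveAut θ) {r : W}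
    (hr : cs.IsReflection r) (hfix : θ r = r) {t : W} (ht : t * t = 1) (hrt : θ t = r * t * r) :
    θ t = t := by
  induction hn : cs.length r using Nat.strong_induction_on generalizing r t with
  | _ n ih =>
    have hrr := hr.mul_self
    have hr1 : r ≠ 1 := by
      rintro rfl
      simpa using hr.odd_length
    obtain ⟨i, hi⟩ := cs.exists_rightDescent_of_ne_one hr1
    have hi : cs.length (r * cs.simple i) < cs.length r := hi
    have hcomm : cs.simple i * r = r * cs.simple i → r = cs.simple i := fun h ↦
      cs.eq_simple_of_commute hr h.symm hi
    obtain ⟨j, hij⟩ := hθ.map_simple i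
    have hji : θ (cs.simple j) = cs.simple i := by rw [← hij, hθ.involutive]
    -- Conjugating r and t by a θ-fixed involution keeps every hypothesis, so the induction applies
    -- once r gets shorter.
    have hconj : ∀ g : W, g * g = 1 → θ g = g → cs.length (g * r * g) < cs.length r →
        θ t = t := by
      intro g hg hgf hl
      have hginv := inv_eq_of_mul_eq_one_left hg
      have h1 : cs.IsReflection (g * r * g) := by
        have := hr.conj g
        rwa [hginv] at this
      have e : ∀ x y : W, g * x * g * (g * y * g) = g * (x * y) * g := by
        intro x y
        simp only [mul_assoc]
        rw [← mul_assoc g g, hg, one_mul]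
      have := ih _ (hn ▸ hl) h1 (by simp [hgf, hfix]) (t := g * t * g)
        (by rw [e, ht, mul_one, hg]) (by rw [e, e, map_mul, map_mul, hgf, hrt]) rfl
      rw [map_mul, map_mul, hgf] at this
      exact mul_left_cancel (mul_right_cancel this)
    by_cases hne : cs.simple i = cs.simple j
    · rw [← hne] at hij
      rcases length_conj_of_descent hrr hi with h | h
      -- θ preserves length, whereas conjugating an involution by s_i is trivial or changes the
      -- length by 2.
      · have hri := hcomm h
        rw [hri] at hrt
        have hl := hθ.length_map t
        by_contra hcon
        rw [hrt] at hl hcon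
        rcases lt_or_gt_of_ne (cs.length_mul_simple_ne t i) with hlt | hlt
        · rcases length_conj_of_descent ht hlt with h | h
          · rw [h] at hcon
            simp at hcon
          · omega
        · rcases cs.simple_mul_eq_or_length_add_two (i := i) (j := i) hlt
            (by rwa [length_simple_mul_of_involution ht]) with h | h
          · rw [h] at hcon
            simp at hcon
          · omega
      · exact hconj _ (cs.simple_mul_simple_self i) hij (by omega)
    -- As r is θ-fixed, both generators are descents of r, and v in r = xv is longest in the
    -- dihedral group; NOF makes it θ-fixed and central there.
    · have hdj : cs.length (r * cs.simple j) < cs.length r := by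
        rw [← hθ.length_map, map_mul, hji, hfix]
        exact hi
      obtain ⟨x, hxv, hx⟩ := cs.exists_min_coset_rep {i, j} r
      set v := x⁻¹ * r with hv
      have hr' : r = x * v := by simp [hv]
      clear_value v
      have hI : i ∈ ({i, j} : Set B) := by simp
      have hJ : j ∈ ({i, j} : Set B) := by simp
      have hdv : ∀ k ∈ ({i, j} : Set B), cs.length (r * cs.simple k) < cs.length r →
          cs.length (v * cs.simple k) < cs.length v := by
        intro k hk h
        rw [← cs.eta_eq_one_iff (cs.isReflection_simple k), hr',
          eta_mul_of_mem_parabolic hx hxv hk] at h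
        exact cs.length_lt_of_eta h
      have hvi := hdv i hI hi
      have hvj := hdv j hJ hdj
      have hlr : cs.length r = cs.length x + cs.length v := by
        rw [hr', length_mul_of_mem_parabolic hx hxv]
      obtain ⟨⟨k, hk⟩, hvv, hvf⟩ := hNOF.longest_eq_zpow hθ hij hne hxv hvi hvj
      have hvinv := inv_eq_of_mul_eq_one_left hvv
      have hcv : ∀ m ∈ ({i, j} : Set B), cs.simple m * v = v * cs.simple m := by
        have h1 : cs.simple i * v = v * cs.simple i := by
          have h := conj_zpow (a := cs.simple i) (b := cs.simple i * cs.simple j) (i := k)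
          have e : cs.simple i * (cs.simple i * cs.simple j) * (cs.simple i)⁻¹ =
              (cs.simple i * cs.simple j)⁻¹ := by simp
          rw [e, inv_zpow, ← hk, hvinv] at h
          conv_rhs => rw [h]
          simp
        rintro m (rfl | rfl)
        · exact h1
        · have := congrArg θ h1
          rwa [map_mul, map_mul, hij, hvf] at this
      by_cases hl : cs.length (v * r * v) < cs.length r
      · exact hconj v hvv hvf hl
      exfalso
      have hrv : r * v = x := by rw [hr', mul_assoc, hvv, mul_one]
      -- Now vrv = vx is not shorter than r, so ℓ(vx) = ℓ(v) + ℓ(x), and a left descent of x in {i,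
      -- j} would violate this.
      have hasc : ∀ m ∈ ({i, j} : Set B), cs.length (v * cs.simple m) < cs.length v →
          cs.length x < cs.length (cs.simple m * x) := by
        intro m hm hvm
        by_contra hcon
        have h1 := cs.length_simple_mul x m
        have h2 := cs.length_mul_le (v * cs.simple m) (cs.simple m * x)
        rw [mul_assoc, simple_mul_simple_cancel_left, ← hrv, ← mul_assoc] at h2
        rw [← hrv] at hcon h1 hlr
        omega
      -- Without such b, s_i r = (s_i x)v would be longer than r, although s_i is a left descent of
      -- r.
      obtain ⟨b, hb, hlb⟩ : ∃ b ∈ ({i, j} : Set B),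
          ¬ cs.length (cs.simple i * x) < cs.length (cs.simple i * x * cs.simple b) := by
        by_contra! hcon
        have h1 := length_mul_of_mem_parabolic hcon hxv
        have h2 := hasc i hI hvi
        rw [mul_assoc, ← hr', length_simple_mul_of_involution hrr] at h1
        omega
      have hxb : cs.simple i * x = x * cs.simple b := by
        rcases cs.simple_mul_eq_or_length_add_two (hx b hb) (hasc i hI hvi) with h | h
        · exact h
        · have := cs.length_simple_mul x i
          omega
      have hrb : cs.simple i * r = r * cs.simple b := by
        rw [hr', ← mul_assoc, hxb, mul_assoc, hcv b hb, mul_assoc]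
      rcases hb with rfl | rfl
      · rw [hcomm hrb, hij] at hfix
        exact hne hfix.symm
      -- Here r conjugates s_i to s_j. Then x = vr = rv is a shorter θ-fixed reflection that also
      -- does so, and the induction hypothesis for x and t = s_i gives θ(s_i) = s_i.
      · have hrr' : r * cs.simple i * r = cs.simple b := by
          rw [mul_assoc, hrb, ← mul_assoc, hrr, one_mul]
        have hvr := isReflection_zpow_mul hr (cs.simple_mul_simple_self i) hrr' k
        have hvrx : v * r = x := by
          rw [← hk] at hvr
          rw [← hvr.inv, mul_inv_rev, hr.inv, hvinv, hrv]
        rw [← hk, hvrx] at hvr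
        refine hne ?_
        rw [← hij]
        refine (ih _ ?_ hvr ?_ (cs.simple_mul_simple_self i) ?_ rfl).symm
        · omega
        · rw [← hrv, map_mul, hfix, hvf]
        · conv_rhs => rw [← hrv]
          rw [mul_assoc r, ← hcv i hI, hrv, ← hvrx, hij, ← hrr']
          simp only [← mul_assoc]
          rw [mul_assoc (r * cs.simple i) v, hvv, mul_one]

end CoxeterSystem

/-! ### Twisted conjugation on twisted identities. -/

namespace CoxeterSystem

variable {B W : Type*} [Group W] {M : CoxeterMatrix B} {cs : CoxeterSystem M W} {θ : W ≃* W}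

variable (cs θ) in
/-- The twisted conjugation by a simple reflection. -/
def twistedConj (i : B) (x : W) : W := θ (cs.simple i) * x * cs.simple i

theorem twistedConj_twistedConj (i : B) (x : W) :
    cs.twistedConj θ i (cs.twistedConj θ i x) = x := by
  have : θ (cs.simple i) * θ (cs.simple i) = 1 := by rw [← map_mul]; simp
  simp only [twistedConj, mul_assoc, simple_mul_simple_self, mul_one]
  rw [← mul_assoc, this, one_mul]

theorem twistedConj_injective (i : B) : Function.Injective (cs.twistedConj θ i) :=
  Function.Involutive.injective (twistedConj_twistedConj i)

theorem twistedConj_eq_self_iff {i : B} {x : W} :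
    cs.twistedConj θ i x = x ↔ θ (cs.simple i) * x = x * cs.simple i := by
  rw [twistedConj]
  constructor
  · intro h
    have := congrArg (· * cs.simple i) h
    simpa using this
  · intro h
    rw [h, simple_mul_simple_cancel_right]

theorem twistedConj_mem {i : B} {x : W} (hx : x ∈ twistedIdentities θ) :
    cs.twistedConj θ i x ∈ twistedIdentities θ := by
  obtain ⟨w, rfl⟩ := hx
  exact ⟨cs.simple i * w, by simp [twistedConj, mul_assoc]⟩

namespace IsInvolutiveAut

theorem map_mem (hθ : cs.IsInvolutiveAut θ) {x : W} (hx : x ∈ twistedIdentities θ) :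
    θ x = x⁻¹ := by
  obtain ⟨w, rfl⟩ := hx
  simp [hθ.involutive]

theorem length_map_simple_mul (hθ : cs.IsInvolutiveAut θ) {x : W} (hx : x ∈ twistedIdentities θ)
    (i : B) : cs.length (θ (cs.simple i) * x) = cs.length (x * cs.simple i) := by
  rw [← length_inv, ← hθ.length_map, mul_inv_rev, ← map_inv, inv_simple, map_mul, hθ.involutive,
    ← hθ.map_mem hx, hθ.involutive]

theorem length_twistedConj_mul_simple (hθ : cs.IsInvolutiveAut θ) {x : W}
    (hx : x ∈ twistedIdentities θ) (i : B) :
    cs.length (cs.twistedConj θ i x * cs.simple i) = cs.length (x * cs.simple i) := by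
  rw [twistedConj, simple_mul_simple_cancel_right, hθ.length_map_simple_mul hx]

theorem length_twistedConj_of_lt (hθ : cs.IsInvolutiveAut θ) {x : W}
    (hx : x ∈ twistedIdentities θ) {i : B} (h : cs.length x < cs.length (x * cs.simple i))
    (hne : cs.twistedConj θ i x ≠ x) : cs.length (cs.twistedConj θ i x) = cs.length x + 2 := by
  have hl := hθ.length_map_simple_mul hx i
  rw [ne_eq, twistedConj_eq_self_iff] at hne
  rw [twistedConj]
  obtain ⟨j, hj⟩ := hθ.map_simple i
  rw [hj] at hl hne ⊢
  exact (cs.simple_mul_eq_or_length_add_two h (hl ▸ h)).resolve_left hne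

/-- A twisted identity is not fixed by the twisted conjugation at one of its descents. -/
theorem twistedConj_ne_self (hθ : cs.IsInvolutiveAut θ) {x : W}
    (hx : x ∈ twistedIdentities θ) {i : B} (h : cs.length (x * cs.simple i) < cs.length x) :
    cs.twistedConj θ i x ≠ x := by
  rw [ne_eq, twistedConj_eq_self_iff]
  intro hfix
  rw [← cs.eta_eq_one_iff (cs.isReflection_simple i)] at h
  obtain ⟨v, rfl⟩ := hx
  have hrefl : cs.IsReflection (v⁻¹ * cs.simple i * v) := by
    simpa using (cs.isReflection_simple i).conj v⁻¹
  have ht : θ (v⁻¹ * cs.simple i * v) = v⁻¹ * cs.simple i * v := by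
    have := congrArg (fun y ↦ θ v⁻¹ * y * v) hfix
    simpa [mul_assoc] using this
  have he := hθ.eta_map v hrefl
  rw [ht] at he
  -- For x = θ(v)v⁻¹ both terms count the θ-fixed reflection v⁻¹ s_i v for v, so they cancel.
  rw [eta_mul, inv_inv, he, eta_inv, CharTwo.add_self_eq_zero] at h
  exact zero_ne_one h

theorem length_twistedConj_of_gt (hθ : cs.IsInvolutiveAut θ) {x : W}
    (hx : x ∈ twistedIdentities θ) {i : B} (h : cs.length (x * cs.simple i) < cs.length x) :
    cs.length x = cs.length (cs.twistedConj θ i x) + 2 := by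
  have hne := hθ.twistedConj_ne_self hx h
  have hl := hθ.length_map_simple_mul hx i
  rw [ne_eq, twistedConj_eq_self_iff] at hne
  rw [twistedConj]
  obtain ⟨j, hj⟩ := hθ.map_simple i
  rw [hj] at hl hne ⊢
  exact (cs.simple_mul_eq_or_length_eq_add_two h (hl ▸ h)).resolve_left hne

theorem ascent_twistedConj (hθ : cs.IsInvolutiveAut θ) {x : W} (hx : x ∈ twistedIdentities θ)
    {i : B} (h : cs.length (x * cs.simple i) < cs.length x) :
    cs.length (cs.twistedConj θ i x) < cs.length (cs.twistedConj θ i x * cs.simple i) := by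
  rw [hθ.length_twistedConj_mul_simple hx]
  have := hθ.length_twistedConj_of_gt hx h
  have := cs.length_mul_simple x i
  omega

theorem descent_twistedConj (hθ : cs.IsInvolutiveAut θ) {x : W} (hx : x ∈ twistedIdentities θ)
    {i : B} (h : cs.length x < cs.length (x * cs.simple i)) (hne : cs.twistedConj θ i x ≠ x) :
    cs.length (cs.twistedConj θ i x * cs.simple i) < cs.length (cs.twistedConj θ i x) := by
  rw [hθ.length_twistedConj_mul_simple hx]
  have := hθ.length_twistedConj_of_lt hx h hne
  have := cs.length_mul_simple x i
  omega

theorem twistedConj_le (hθ : cs.IsInvolutiveAut θ) {x y : W} (hy : y ∈ twistedIdentities θ)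
    (h : cs.BruhatLE x y) {i : B} (hd : cs.length (y * cs.simple i) < cs.length y) :
    cs.BruhatLE (cs.twistedConj θ i x) y := by
  have hl := hθ.length_map_simple_mul hy i
  rw [twistedConj, mul_assoc]
  obtain ⟨j, hj⟩ := hθ.map_simple i
  rw [hj] at hl ⊢
  exact (h.mul_simple_le hd).simple_mul_le (hl ▸ hd)

theorem le_twistedConj (hθ : cs.IsInvolutiveAut θ) {x y : W} (hx : x ∈ twistedIdentities θ)
    (h : cs.BruhatLE x y) {i : B} (hd : cs.length x < cs.length (x * cs.simple i)) :
    cs.BruhatLE x (cs.twistedConj θ i y) := by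
  have hl := hθ.length_map_simple_mul hx i
  rw [twistedConj, mul_assoc]
  obtain ⟨j, hj⟩ := hθ.map_simple i
  rw [hj] at hl ⊢
  exact (h.le_mul_simple hd).le_simple_mul (hl ▸ hd)

theorem twistedConj_le_self (hθ : cs.IsInvolutiveAut θ) {x : W} (hx : x ∈ twistedIdentities θ)
    {i : B} (hd : cs.length (x * cs.simple i) < cs.length x) :
    cs.BruhatLE (cs.twistedConj θ i x) x :=
  hθ.twistedConj_le hx .refl hd

theorem twistedConj_le_twistedConj_of_gt (hθ : cs.IsInvolutiveAut θ) {x y : W}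
    (hx : x ∈ twistedIdentities θ) (h : cs.BruhatLE x y) {i : B}
    (hd : cs.length (x * cs.simple i) < cs.length x) :
    cs.BruhatLE (cs.twistedConj θ i x) (cs.twistedConj θ i y) :=
  hθ.le_twistedConj (twistedConj_mem hx) ((hθ.twistedConj_le_self hx hd).trans h)
    (hθ.ascent_twistedConj hx hd)

theorem twistedConj_le_twistedConj_of_lt (hθ : cs.IsInvolutiveAut θ) {x y : W}
    (hy : y ∈ twistedIdentities θ) (h : cs.BruhatLE x y) {i : B}
    (hd : cs.length y < cs.length (y * cs.simple i)) (hne : cs.twistedConj θ i y ≠ y) :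
    cs.BruhatLE (cs.twistedConj θ i x) (cs.twistedConj θ i y) :=
  hθ.twistedConj_le (twistedConj_mem hy) (h.trans (hθ.le_twistedConj hy .refl hd))
    (hθ.descent_twistedConj hy hd hne)

/-- If an element `r` of a parabolic subgroup commutes, up to a twist, with a twisted identity `c`
without descents in that subgroup, then `c` sends a descent of `r` to a generator. -/
theorem exists_twisted_commute (hθ : cs.IsInvolutiveAut θ) {J : Set B} {c r : W}
    (hc : c ∈ twistedIdentities θ) (hasc : ∀ j ∈ J, cs.length c < cs.length (c * cs.simple j))
    (hr : r ∈ cs.parabolic J) (hr1 : r ≠ 1) (hcr : θ r * c = c * r) :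
    ∃ b ∈ J, ∃ d ∈ J, cs.length (r * cs.simple b) < cs.length r ∧
      c * cs.simple b = θ (cs.simple d) * c := by
  obtain ⟨b, hb, hrb⟩ := exists_eta_of_mem_parabolic hr hr1
  have h1 : cs.eta (c * r) (cs.simple b) = 1 := by
    rw [eta_mul_of_mem_parabolic hasc hr hb, hrb]
  rw [← hcr, eta_mul, (cs.eta_eq_zero_iff (cs.isReflection_simple b)).mpr (hasc b hb), zero_add] at h1
  -- Since s_b is no inversion of c, the inversion of θ(r)c at s_b comes from θ(r).
  have hrefl : cs.IsReflection (c * cs.simple b * c⁻¹) := (cs.isReflection_simple b).conj c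
  rw [← hθ.involutive (c * cs.simple b * c⁻¹), hθ.eta_map r (hθ.isReflection_map hrefl)] at h1
  have hd := mem_parabolic_of_eta hr h1
  set d := θ (c * cs.simple b * c⁻¹) with hdef
  have hcb : c * cs.simple b = θ d * c := by
    rw [hdef, hθ.involutive]
    simp
  -- The inverse of θ(d)c is θ(cd⁻¹), of length ℓ(c) + ℓ(d), while c s_b has length ℓ(c) + 1.
  have hdl : cs.length d = 1 := by
    have h2 : cs.length (θ d * c) = cs.length c + cs.length d := by
      rw [← cs.length_inv d, ← length_mul_of_mem_parabolic hasc (inv_mem hd), ← length_inv,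
        mul_inv_rev, ← hθ.map_mem hc, ← map_inv, ← map_mul, hθ.length_map]
    rw [← hcb] at h2
    have h3 := cs.length_mul_simple c b
    have h4 := hasc b hb
    omega
  obtain ⟨k, hk, hdk⟩ := exists_simple_of_mem_parabolic hd hdl
  exact ⟨b, hb, k, hk, cs.length_lt_of_eta hrb, by rw [hcb, hdk]⟩

end IsInvolutiveAut

/-- Under the no odd flip property, a twisted identity does not interchange two simple reflections,
up to a twist, while it fixes a reflection of the dihedral subgroup that they generate. -/
theorem IsNOF.simple_eq_of_swap (hNOF : cs.IsNOF θ) (hθ : cs.IsInvolutiveAut θ) {c r : W} {p q : B}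
    (hc : c ∈ twistedIdentities θ) (hr : cs.IsReflection r) (hrm : r ∈ cs.parabolic {p, q})
    (hcr : θ r * c = c * r) (hpq : c * cs.simple p = θ (cs.simple q) * c) :
    cs.simple p = cs.simple q := by
  have hqp : c * cs.simple q = θ (cs.simple p) * c := by
    have := congrArg (fun x ↦ θ x⁻¹) hpq
    simp only [mul_inv_rev, map_mul, map_inv, hθ.map_mem hc, hθ.involutive, inv_inv] at this
    simpa [← map_inv] using this.symm
  obtain ⟨k, hk⟩ := eq_zpow_of_mem_parabolic_pair hrm
  -- Reflections have odd length, so r is not a power of s_p s_q.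
  have hodd : r = (cs.simple p * cs.simple q) ^ k * cs.simple p := by
    refine hk.resolve_left fun h ↦ ?_
    have h1 := hr.odd_length
    have h2 := cs.lengthParity_eq_ofAdd_length r
    rw [h, map_zpow, map_mul, lengthParity_simple, lengthParity_simple, ← ofAdd_add,
      CharTwo.add_self_eq_zero, ofAdd_zero, one_zpow, ← h] at h2
    have h3 : ((cs.length r : ℕ) : ZMod 2) = 0 := (ofAdd_eq_one.mp h2.symm)
    rw [ZMod.natCast_eq_zero_iff_even] at h3
    exact Nat.not_even_iff_odd.mpr h1 h3
  have hinv : cs.simple q * cs.simple p = (cs.simple p * cs.simple q)⁻¹ := by simp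
  have hrswap : r = ((cs.simple p * cs.simple q) ^ k)⁻¹ * cs.simple q := by
    have h1 : c * cs.simple p * c⁻¹ = θ (cs.simple q) := by rw [hpq]; simp
    have h2 : c * cs.simple q * c⁻¹ = θ (cs.simple p) := by rw [hqp]; simp
    have h3 : c * r * c⁻¹ = θ r := by rw [← hcr]; simp
    apply θ.injective
    have e : c * r * c⁻¹ = (c * cs.simple p * c⁻¹ * (c * cs.simple q * c⁻¹)) ^ k *
        (c * cs.simple p * c⁻¹) := by
      rw [conj_mul, conj_zpow, conj_mul, ← hodd]
    rw [← h3, e, h1, h2, ← map_mul, ← map_zpow, ← map_mul, hinv, inv_zpow]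
  have hrp : r * cs.simple p * r = cs.simple q := by
    nth_rw 2 [hrswap]
    rw [hodd]
    simp
  -- With c = θ(v)v⁻¹, conjugation by v⁻¹ untwists the relations: v⁻¹rv is θ-fixed, and θ acts on
  -- v⁻¹ s_p v as conjugation by it.
  obtain ⟨v, rfl⟩ := hc
  have hfix : θ (v⁻¹ * r * v) = v⁻¹ * r * v := by
    have := congrArg (fun y ↦ θ v⁻¹ * y * v) hcr
    simpa [mul_assoc] using this
  have hsw : θ (v⁻¹ * cs.simple p * v) = v⁻¹ * cs.simple q * v := by
    have := congrArg (fun y ↦ θ v⁻¹ * y * v) hqp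
    simpa [mul_assoc] using this.symm
  have hrefl : cs.IsReflection (v⁻¹ * r * v) := by simpa using hr.conj v⁻¹
  have h := hNOF.map_eq_self hθ hrefl hfix (t := v⁻¹ * cs.simple p * v) (by simp [mul_assoc])
    (by rw [hsw, ← hrp]; simp [mul_assoc])
  rw [hsw] at h
  exact (mul_left_cancel (mul_right_cancel h)).symm

/-- As c does not swap the generators and p does not fix c, every such reflection has q as a
descent. If r did not commute with s_q, then s_q r s_q would be another such reflection without that
descent. -/
theorem IsNOF.eq_simple_of_twisted_commute (hNOF : cs.IsNOF θ) (hθ : cs.IsInvolutiveAut θ)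
    {c r : W} {p q : B} (hc : c ∈ twistedIdentities θ)
    (hasc : ∀ j ∈ ({p, q} : Set B), cs.length c < cs.length (c * cs.simple j))
    (hp : cs.twistedConj θ p c ≠ c) (hr : cs.IsReflection r) (hrm : r ∈ cs.parabolic {p, q})
    (hcr : θ r * c = c * r) : r = cs.simple q ∧ cs.twistedConj θ q c = c := by
  have key : ∀ r, cs.IsReflection r → r ∈ cs.parabolic {p, q} → θ r * c = c * r →
      cs.length (r * cs.simple q) < cs.length r ∧ cs.twistedConj θ q c = c := by
    intro r hr hrm hcr
    have hr1 : r ≠ 1 := by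
      rintro rfl
      simpa using hr.odd_length
    obtain ⟨b, hb, d, hd, hrb, hbd⟩ := hθ.exists_twisted_commute hc hasc hrm hr1 hcr
    have hsame : cs.simple b = cs.simple d := by
      rcases hb with rfl | rfl <;> rcases hd with rfl | rfl
      · rfl
      · exact hNOF.simple_eq_of_swap hθ hc hr hrm hcr hbd
      · rw [Set.pair_comm] at hrm
        exact hNOF.simple_eq_of_swap hθ hc hr hrm hcr hbd
      · rfl
    rw [← hsame] at hbd
    have hfix : cs.twistedConj θ b c = c := twistedConj_eq_self_iff.mpr hbd.symm
    rcases hb with rfl | rfl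
    · exact absurd hfix hp
    · exact ⟨hrb, hfix⟩
  obtain ⟨hd, hfix⟩ := key r hr hrm hcr
  refine ⟨?_, hfix⟩
  rcases length_conj_of_descent hr.mul_self hd with h | h
  · exact cs.eq_simple_of_commute hr h.symm hd
  · exfalso
    have hq : cs.simple q ∈ cs.parabolic {p, q} := simple_mem_parabolic (by simp)
    have hfix' := twistedConj_eq_self_iff.mp hfix
    have h1 := (key (cs.simple q * r * cs.simple q)
      (by simpa using hr.conj (cs.simple q)) (mul_mem (mul_mem hq hrm) hq) (by
        rw [map_mul, map_mul, mul_assoc, hfix', ← mul_assoc, mul_assoc (θ (cs.simple q)), hcr,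
          ← mul_assoc, hfix', mul_assoc, mul_assoc, mul_assoc])).1
    rw [simple_mul_simple_cancel_right] at h1
    have := cs.length_simple_mul r q
    omega

end CoxeterSystem

/-! ### Alternating descents, gradedness and the matching. -/

namespace CoxeterSystem

variable {B W : Type*} [Group W] {M : CoxeterMatrix B} {cs : CoxeterSystem M W} {θ : W ≃* W}

theorem length_map_mul_mul_le (hθ : cs.IsInvolutiveAut θ) (u c : W) :
    cs.length (θ u * c * u⁻¹) ≤ cs.length c + 2 * cs.length u := by
  have h1 := cs.length_mul_le (θ u * c) u⁻¹
  have h2 := cs.length_mul_le (θ u) c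
  rw [hθ.length_map] at h2
  rw [length_inv] at h1
  omega

/-- Descending from `z` by alternating twisted conjugations at `j` and `i` ends at a twisted identity
`c` without descents in `{i, j}`, and elements of colength two that are not reached by the descent
follow it in parallel. -/
theorem IsInvolutiveAut.exists_alternating_descent (hθ : cs.IsInvolutiveAut θ) {z : W} {i j : B}
    (hz : z ∈ twistedIdentities θ) (hzi : cs.length z < cs.length (z * cs.simple i)) :
    ∃ c u p q, ({p, q} : Set B) = {i, j} ∧ c ∈ twistedIdentities θ ∧ u ∈ cs.parabolic {p, q} ∧
      z = θ u * c * u⁻¹ ∧ cs.length z = cs.length c + 2 * cs.length u ∧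
      (∀ k ∈ ({p, q} : Set B), cs.length c < cs.length (c * cs.simple k)) ∧
      (cs.twistedConj θ p c ≠ c ∨ c = z ∧ p = i) ∧
      (cs.length z < cs.length (z * cs.simple j) → c = z ∧ q = j) ∧
      ∀ x ∈ twistedIdentities θ, cs.BruhatLE x z → cs.length z = cs.length x + 2 →
        cs.length x < cs.length (x * cs.simple i) → cs.twistedConj θ i x ≠ x →
        cs.twistedConj θ q c = c →
        ∃ x' ∈ twistedIdentities θ, x = θ u * x' * u⁻¹ ∧ cs.BruhatLE x' c ∧
          cs.length c = cs.length x' + 2 := by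
  induction hn : cs.length z using Nat.strong_induction_on generalizing z i j with
  | _ n ih =>
    rcases lt_or_gt_of_ne (cs.length_mul_simple_ne z j).symm with hzj | hzj
    · refine ⟨z, 1, i, j, rfl, hz, one_mem _, by simp, by simp [hn], ?_, Or.inr ⟨rfl, rfl⟩,
        fun _ ↦ ⟨rfl, rfl⟩, fun x hx hle hl _ _ _ ↦ ⟨x, hx, by simp, hle, by omega⟩⟩
      rintro k (rfl | rfl)
      exacts [hzi, hzj]
    · have hz1 := twistedConj_mem (cs := cs) (i := j) hz
      have hl1 := hθ.length_twistedConj_of_gt hz hzj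
      have hasc1 := hθ.ascent_twistedConj hz hzj
      have hne1 := hθ.twistedConj_ne_self hz hzj
      obtain ⟨c, u, p, q, hpq, hc, hu, hzu, hlu, hasc, hp, hq, hx⟩ :=
        ih _ (by omega) (i := j) (j := i) hz1 hasc1 rfl
      have hpq' : ({p, q} : Set B) = {i, j} := by rw [hpq, Set.pair_comm]
      have htrans : ∀ y y', cs.twistedConj θ j y = θ u * y' * u⁻¹ →
          y = θ (cs.simple j * u) * y' * (cs.simple j * u)⁻¹ := by
        intro y y' h
        rw [← cs.twistedConj_twistedConj (θ := θ) j y, h, twistedConj]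
        simp [mul_assoc]
      have hzu' := htrans _ _ hzu
      -- Each step lowers the length by 2 and adds at most one letter to u, so the general upper
      -- bound is attained.
      have hlu' : cs.length z = cs.length c + 2 * cs.length (cs.simple j * u) := by
        have h1 := length_map_mul_mul_le hθ (cs.simple j * u) c
        rw [← hzu'] at h1
        have h2 := cs.length_mul_le (cs.simple j) u
        rw [length_simple] at h2
        omega
      refine ⟨c, cs.simple j * u, p, q, hpq', hc, mul_mem (simple_mem_parabolic (by simp [hpq])) hu,
        hzu', hn ▸ hlu', hasc, ?_, fun h ↦ absurd h (by omega), ?_⟩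
      · left
        rcases hp with hp | ⟨rfl, rfl⟩
        · exact hp
        · rw [twistedConj_twistedConj]
          exact hne1.symm
      · intro x hxm hle hlx hxi hxne hqc
        -- Otherwise x lies below θ(s_j)zs_j at equal length, hence equals it; having the ascent i,
        -- it ends the descent with c = x and q = i, so i would fix x.
        have hxj : cs.length (x * cs.simple j) < cs.length x := by
          by_contra hcon
          have hxj := lt_of_le_of_ne (not_lt.mp hcon) (cs.length_mul_simple_ne x j).symm
          have hxz : x = cs.twistedConj θ j z :=
            (hθ.le_twistedConj hxm hle hxj).eq_of_length_le (by omega)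
          rw [← hxz] at hq
          obtain ⟨rfl, rfl⟩ := hq hxi
          exact hxne hqc
        have hx1 := hθ.twistedConj_ne_self hxm hxj
        have hlx1 := hθ.length_twistedConj_of_gt hxm hxj
        obtain ⟨x', hx'm, hxx', hle', hl'⟩ := hx (cs.twistedConj θ j x) (twistedConj_mem hxm)
          (hθ.twistedConj_le_twistedConj_of_gt hxm hle hxj) (by omega)
          (hθ.ascent_twistedConj hxm hxj) (by rw [twistedConj_twistedConj]; exact hx1.symm) hqc
        exact ⟨x', hx'm, htrans _ _ hxx', hle', hl'⟩

/-- Under the no odd flip property, if the twisted conjugation at an ascent of `z` fixes `z`, then it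
fixes each element of colength two below `z` that has the same ascent. -/
theorem IsNOF.twistedConj_eq_self (hNOF : cs.IsNOF θ) (hθ : cs.IsInvolutiveAut θ) {x z : W} {i : B}
    (hz : z ∈ twistedIdentities θ) (hx : x ∈ twistedIdentities θ) (hle : cs.BruhatLE x z)
    (hl : cs.length z = cs.length x + 2) (hzi : cs.length z < cs.length (z * cs.simple i))
    (hzf : cs.twistedConj θ i z = z) (hxi : cs.length x < cs.length (x * cs.simple i)) :
    cs.twistedConj θ i x = x := by
  induction hn : cs.length z using Nat.strong_induction_on generalizing x z i with
  | _ n ih =>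
    by_contra hxne
    have hz1 : z ≠ 1 := by
      rintro rfl
      simp at hl
    obtain ⟨j, hj⟩ := cs.exists_rightDescent_of_ne_one hz1
    have hj : cs.length (z * cs.simple j) < cs.length z := hj
    obtain ⟨c, u, p, q, hpq, hc, hu, hzu, hlu, hasc, hp, -, hpar⟩ :=
      hθ.exists_alternating_descent (j := j) hz hzi
    have hcz : c ≠ z := by
      rintro rfl
      have := hasc j (by simp [hpq])
      omega
    replace hp := hp.resolve_right fun h ↦ hcz h.1
    have hi : cs.simple i ∈ cs.parabolic {p, q} := simple_mem_parabolic (by simp [hpq])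
    have hr : cs.IsReflection (u⁻¹ * cs.simple i * u) := by
      simpa using (cs.isReflection_simple i).conj u⁻¹
    have hcr : θ (u⁻¹ * cs.simple i * u) * c = c * (u⁻¹ * cs.simple i * u) := by
      have := congrArg (fun y ↦ θ u⁻¹ * y * u) (twistedConj_eq_self_iff.mp hzf)
      rw [hzu] at this
      simpa [mul_assoc] using this
    obtain ⟨hrq, hqc⟩ := hNOF.eq_simple_of_twisted_commute hθ hc hasc hp hr
      (mul_mem (mul_mem (inv_mem hu) hi) hu) hcr
    have hiu : cs.simple i * u = u * cs.simple q := by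
      rw [← hrq]
      simp [mul_assoc]
    obtain ⟨x', hx'm, hxx', hle', hl'⟩ := hpar x hx hle hl hxi hxne hqc
    have hconj : cs.twistedConj θ i x = θ u * cs.twistedConj θ q x' * u⁻¹ := by
      have e : u⁻¹ * cs.simple i = cs.simple q * u⁻¹ := by
        rw [← hrq]
        simp [mul_assoc]
      rw [hxx', twistedConj, twistedConj]
      calc θ (cs.simple i) * (θ u * x' * u⁻¹) * cs.simple i
          = θ (cs.simple i * u) * x' * (u⁻¹ * cs.simple i) := by simp only [map_mul, mul_assoc]
        _ = _ := by rw [e, hiu]; simp only [map_mul, mul_assoc]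
    have hne' : cs.twistedConj θ q x' ≠ x' := by
      intro h
      rw [h, ← hxx'] at hconj
      exact hxne hconj
    have hux : 0 < cs.length u := by
      rw [Nat.pos_iff_ne_zero, ne_eq, length_eq_zero_iff]
      rintro rfl
      exact hcz (by simpa using hzu.symm)
    -- A descent q of x' would bound the length of θ(s_i)xs_i by ℓ(x) - 2, but it is ℓ(x) + 2.
    rcases lt_or_gt_of_ne (cs.length_mul_simple_ne x' q) with h | h
    · have h1 := hθ.length_twistedConj_of_gt hx'm h
      have h2 := hθ.length_twistedConj_of_lt hx hxi hxne
      have h3 := length_map_mul_mul_le hθ u (cs.twistedConj θ q x')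
      rw [← hconj] at h3
      omega
    · exact hne' (ih _ (by omega) hc hx'm hle' hl' (hasc q (by simp)) hqc h rfl)

/-- Under the no odd flip property, the twisted identities are graded by half of the length. -/
theorem IsNOF.exists_between (hNOF : cs.IsNOF θ) (hθ : cs.IsInvolutiveAut θ) {x y : W}
    (hx : x ∈ twistedIdentities θ) (hy : y ∈ twistedIdentities θ) (hle : cs.BruhatLE x y)
    (hne : x ≠ y) :
    ∃ z ∈ twistedIdentities θ, cs.BruhatLE x z ∧ cs.BruhatLE z y ∧
      cs.length z = cs.length x + 2 := by
  induction hn : cs.length y using Nat.strong_induction_on generalizing x y with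
  | _ n ih =>
    have hy1 : y ≠ 1 := by
      rintro rfl
      exact hne (hle.eq_of_length_le (by simp))
    obtain ⟨i, hi⟩ := cs.exists_rightDescent_of_ne_one hy1
    have hi : cs.length (y * cs.simple i) < cs.length y := hi
    have hym := twistedConj_mem (cs := cs) (i := i) hy
    have hxm := twistedConj_mem (cs := cs) (i := i) hx
    have hly := hθ.length_twistedConj_of_gt hy hi
    have hyle := hθ.twistedConj_le_self hy hi
    have hyasc := hθ.ascent_twistedConj hy hi
    have hyne := hθ.twistedConj_ne_self hy hi
    have hbelow : ∀ x ∈ twistedIdentities θ, cs.BruhatLE x (cs.twistedConj θ i y) →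
        x ≠ cs.twistedConj θ i y → ∃ z ∈ twistedIdentities θ, cs.BruhatLE x z ∧
          cs.BruhatLE z (cs.twistedConj θ i y) ∧ cs.length z = cs.length x + 2 :=
      fun x hx hle hne ↦ ih _ (by omega) hx hym hle hne rfl
    have hbelow' : cs.BruhatLE x (cs.twistedConj θ i y) → x ≠ cs.twistedConj θ i y →
        ∃ z ∈ twistedIdentities θ, cs.BruhatLE x z ∧ cs.BruhatLE z y ∧
          cs.length z = cs.length x + 2 := fun h h' ↦ by
      obtain ⟨z, hz, h1, h2, h3⟩ := hbelow x hx h h'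
      exact ⟨z, hz, h1, h2.trans hyle, h3⟩
    rcases lt_or_gt_of_ne (cs.length_mul_simple_ne x i) with hxi | hxi
    · have hlx := hθ.length_twistedConj_of_gt hx hxi
      have hxasc := hθ.ascent_twistedConj hx hxi
      have hxne := hθ.twistedConj_ne_self hx hxi
      obtain ⟨z, hz, hxz, hzy, hlz⟩ := hbelow _ hxm
        (hθ.twistedConj_le_twistedConj_of_gt hx hle hxi)
        (fun h ↦ hne (twistedConj_injective i h))
      -- If i is a descent of z, then x lies below θ(s_i)ys_i and induction applies. Otherwise the
      -- conjugate of z is the required element: were z fixed, θ(s_i)xs_i would be fixed too.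
      rcases lt_or_gt_of_ne (cs.length_mul_simple_ne z i) with hzi | hzi
      · have h1 := hθ.twistedConj_le hz hxz hzi
        rw [twistedConj_twistedConj] at h1
        refine hbelow' (h1.trans hzy) ?_
        intro h
        rw [← h] at hyasc
        omega
      · have hzne : cs.twistedConj θ i z ≠ z := by
          intro h
          have := hNOF.twistedConj_eq_self hθ hz hxm hxz hlz hzi h hxasc
          rw [twistedConj_twistedConj] at this
          exact hxne this.symm
        refine ⟨cs.twistedConj θ i z, twistedConj_mem hz, ?_, ?_, ?_⟩
        · have := hθ.twistedConj_le_twistedConj_of_lt hz hxz hzi hzne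
          rwa [twistedConj_twistedConj] at this
        · exact hθ.twistedConj_le hy (hzy.trans hyle) hi
        · have := hθ.length_twistedConj_of_lt hz hzi hzne
          omega
    · by_cases hxf : cs.twistedConj θ i x = x
      · refine hbelow' (hθ.le_twistedConj hx hle hxi) ?_
        intro h
        rw [h, twistedConj_twistedConj] at hxf
        exact hyne hxf.symm
      · exact ⟨_, hxm, hθ.le_twistedConj hx .refl hxi, hθ.twistedConj_le hy hle hi,
          hθ.length_twistedConj_of_lt hx hxi hxf⟩

theorem Br.length_lt {X : Set W} {x y : cs.Br X} (h : x < y) :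
    cs.length x.val < cs.length y.val := by
  have hle : cs.BruhatLE x.val y.val := h.le
  exact hle.eq_or_length_lt.resolve_left fun h' ↦ h.ne (Br.ext h')

theorem Br.finite_Iic {X : Set W} (w : cs.Br X) : Finite (Set.Iic w) := by
  refine Set.Finite.to_subtype (Set.Finite.of_injOn (f := Br.val)
    (t := {u | cs.BruhatLE u w.val}) ?_ ?_ (finite_setOf_bruhatLE w.val))
  · exact fun x hx ↦ hx
  · exact fun x _ y _ h ↦ Br.ext h

variable (cs) in
/-- The twisted conjugation as a map on a principal order ideal of the twisted identities. -/
def Br.twistedConjIic (hθ : cs.IsInvolutiveAut θ) (w : cs.Br (twistedIdentities θ)) (i : B)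
    (hi : cs.length (w.val * cs.simple i) < cs.length w.val) (x : Set.Iic w) : Set.Iic w :=
  ⟨⟨cs.twistedConj θ i x.val.val, twistedConj_mem x.val.mem⟩, hθ.twistedConj_le w.mem x.2 hi⟩

theorem covBy_of_length_eq_add_two (hθ : cs.IsInvolutiveAut θ) {w : cs.Br (twistedIdentities θ)}
    {x y : Set.Iic w} (hle : x ≤ y) (hl : cs.length y.val.val = cs.length x.val.val + 2) :
    x ⋖ y := by
  have heven : ∀ z : cs.Br (twistedIdentities θ), Even (cs.length z.val) := by
    rintro ⟨_, v, rfl⟩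
    have h := cs.length_mul_mod_two (θ v) v⁻¹
    rw [hθ.length_map, length_inv] at h
    rw [Nat.even_iff]
    show cs.length (θ v * v⁻¹) % 2 = 0
    omega
  refine ⟨lt_of_le_of_ne hle ?_, fun z hxz hzy ↦ ?_⟩
  · rintro rfl
    omega
  · have h1 := Br.length_lt (Subtype.coe_lt_coe.mpr hxz)
    have h2 := Br.length_lt (Subtype.coe_lt_coe.mpr hzy)
    obtain ⟨a, ha⟩ := heven x.val
    obtain ⟨b, hb⟩ := heven z.val
    omega

theorem IsNOF.isSPM_twistedConjIic (hNOF : cs.IsNOF θ) (hθ : cs.IsInvolutiveAut θ)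
    (w : cs.Br (twistedIdentities θ)) (i : B)
    (hi : cs.length (w.val * cs.simple i) < cs.length w.val) :
    IsSPM (Br.twistedConjIic cs hθ w i hi) where
  involutive x := Subtype.ext (Br.ext (twistedConj_twistedConj i x.val.val))
  top_covBy := covBy_of_length_eq_add_two hθ le_top (hθ.length_twistedConj_of_gt w.mem hi)
  covBy_or x := by
    rcases lt_or_gt_of_ne (cs.length_mul_simple_ne x.val.val i) with h | h
    · exact Or.inl (covBy_of_length_eq_add_two hθ (hθ.twistedConj_le_self x.val.mem h)
        (hθ.length_twistedConj_of_gt x.val.mem h))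
    · by_cases hf : cs.twistedConj θ i x.val.val = x.val.val
      · exact Or.inr (Or.inl (Subtype.ext (Br.ext hf)))
      · exact Or.inr (Or.inr (covBy_of_length_eq_add_two hθ (hθ.le_twistedConj x.val.mem .refl h)
          (hθ.length_twistedConj_of_lt x.val.mem h hf)))
  lt_of_covBy x y hxy hne := by
    have hxle : cs.BruhatLE x.val.val y.val.val := hxy.le
    have hxm := x.val.mem
    have hym := y.val.mem
    have hbetween : ∀ z ∈ twistedIdentities θ, cs.BruhatLE x.val.val z → cs.BruhatLE z y.val.val →
        z = x.val.val ∨ z = y.val.val := by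
      intro z hz h1 h2
      have hzw : (⟨z, hz⟩ : cs.Br (twistedIdentities θ)) ∈ Set.Iic w := h2.trans y.2
      rcases hxy.eq_or_eq (c := ⟨⟨z, hz⟩, hzw⟩) h1 h2 with h | h
      · exact Or.inl (congrArg (fun a ↦ a.val.val) h)
      · exact Or.inr (congrArg (fun a ↦ a.val.val) h)
    have hne' : cs.twistedConj θ i x.val.val ≠ y.val.val :=
      fun h ↦ hne (Subtype.ext (Br.ext h))
    refine lt_of_le_of_ne ?_ fun h ↦ hxy.lt.ne (Subtype.ext (Br.ext
      (twistedConj_injective i (congrArg (fun a ↦ a.val.val) h))))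
    show cs.BruhatLE (cs.twistedConj θ i x.val.val) (cs.twistedConj θ i y.val.val)
    rcases lt_or_gt_of_ne (cs.length_mul_simple_ne x.val.val i) with hx | hx
    · exact hθ.twistedConj_le_twistedConj_of_gt hxm hxle hx
    rcases lt_or_gt_of_ne (cs.length_mul_simple_ne y.val.val i) with hy | hy
    · rcases hbetween _ (twistedConj_mem hxm) (hθ.le_twistedConj hxm .refl hx)
        (hθ.twistedConj_le hym hxle hy) with h | h
      · rw [h]
        exact hθ.le_twistedConj hxm hxle hx
      · exact absurd h hne'
    · by_cases hyf : cs.twistedConj θ i y.val.val = y.val.val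
      -- The case beyond lifting: gradedness gives ℓ(y) = ℓ(x) + 2, and then x is fixed together
      -- with y.
      · obtain ⟨z, hz, h1, h2, hl⟩ := hNOF.exists_between hθ hxm hym hxle
          fun h ↦ hxy.lt.ne (Subtype.ext (Br.ext h))
        rcases hbetween z hz h1 h2 with rfl | rfl
        · omega
        · rw [hyf, hNOF.twistedConj_eq_self hθ hym hxm hxle hl hy hyf hx]
          exact hxle
      · exact hθ.twistedConj_le_twistedConj_of_lt hym hxle hy hyf

end CoxeterSystem

theorem mainTheorem3 {B W : Type*} [Group W] {M : CoxeterMatrix B} (cs : CoxeterSystem M W)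
    (θ : W ≃* W) (hθ : cs.IsInvolutiveAut θ) (hNOF : cs.IsNOF θ) :
    IsPircon (cs.Br (twistedIdentities θ)) ∧
      ∀ (w : cs.Br (twistedIdentities θ)) (i : B), cs.BruhatLT (w.val * cs.simple i) w.val →
        Finite (Set.Iic w) ∧
        ∃ m : Set.Iic w → Set.Iic w, IsSPM m ∧
          ∀ x : Set.Iic w, (m x).val.val = θ (cs.simple i) * x.val.val * cs.simple i := by
  constructor
  · intro w hw
    have hw1 : w.val ≠ 1 := by
      intro h
      refine hw fun y hy ↦ ?_
      have hy' : cs.BruhatLE y.val w.val := hy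
      have : y = w := CoxeterSystem.Br.ext (hy'.eq_of_length_le (by simp [h]))
      exact this.ge
    obtain ⟨i, hi⟩ := cs.exists_rightDescent_of_ne_one hw1
    exact ⟨CoxeterSystem.Br.finite_Iic w, _, hNOF.isSPM_twistedConjIic hθ w i hi⟩
  · intro w i hi
    have hl := hi.1.eq_or_length_lt.resolve_left hi.2
    exact ⟨CoxeterSystem.Br.finite_Iic w, _, hNOF.isSPM_twistedConjIic hθ w i hl, fun x ↦ rfl⟩
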